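/- **Setting.** Let $(\Omega,\mathfrak A)$ be a measurable space, let $\mathbb X$ be a metric space with its Borel $\sigma$-algebra, and let $X_t:\Omega\to\mathbb X$ ($t\ge 0$) be measurable. Let $\mathrm H_0$ be a null hypothesis on the law of $X_s$, $s\ge1$, possibly relative to the law of the reference observation $X_0$. For $t\ge1$ let $\mathcal M_{0,t}$ be the set of probability measures on $(\Omega,\mathfrak A)$ under which $\mathrm H_0$ holds at every time $s\in\{1,\dots,t\}$. Let $P_t:\Omega\to[0,1]$, $t\ge1$, be random variables that are super-uniform under $\mathrm H_0$: for every $t\ge1$, $$\mu(P_t\le\alpha)\le\alpha\quad\text{for every }\alpha\in[0,1]\text{ and every }\mu\in\mathcal M_{0,t}.$$ No assumption is made on the dependence between the $P_t$. For $\lambda\in(0,1)$, $r>-1$ with $r\ne0$, and $t\ge1$ put $$w_{t,1}=(1-\lambda)^{t-1},\qquad w_{t,s}=\lambda(1-\lambda)^{t-s}\ (2\le s\le t),\qquad w_{t,\max}=\max_{1\le s\le t}w_{t,s},\qquad S^{(r)}_{\lambda,t}=\sum_{s=1}^{t}w_{t,s}P_s^{r},$$ $$a^{(r)}_{\lambda,t}=\begin{cases}\min\{1+r,\,1/w_{t,\max}\}^{1/r}&\text{if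 }r\ge1,\\(1+r)^{1/r}&\text{if }r\in(-1,1)\setminus\{0\},\end{cases}\qquad Q^{(r)}_{\lambda,t}=a^{(r)}_{\lambda,t}\bigl[S^{(r)}_{\lambda,t}\bigr]^{1/r},$$ where for $r<0$ we read $0^{r}=\infty$ and $\infty^{1/r}=0$. **Proposition 5.** For every $\lambda\in(0,1)$ and every $r>-1$ with $r\neq0$, the $Q^{(r)}_{\lambda,t}$, $t\ge1$, are random variables and the sequence $\bigl(Q^{(r)}_{\lambda,t}\bigr)_{t\ge1}$ is again super-uniform under $\mathrm H_0$: for every $t\ge1$, $\alpha\in[0,1]$ and $\mu\in\mathcal M_{0,t}$, $\mu\bigl(Q^{(r)}_{\lambda,t}\le\alpha\bigr)\le\alpha$. In particular, if $\mathrm P_0$ belongs to $\mathcal M_{0,t}$ for all $t\ge1$, then for each $\alpha\in[0,1]$, $$\mathrm P_0\bigl(Q^{(r)}_{\lambda,t}\le\alpha\bigr)\le\alpha\quad\text{for all }t\ge1.$$ -/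

import Mathlib

open MeasureTheory
open scoped ENNReal

namespace EWMAChart

noncomputable section

/-- `M_{0,t}`: the probability measures on `Ω` under which the monitored process is in control
at every time `s ∈ {1, …, t}`. The null hypothesis `H₀` is a property of the law of `X s`,
possibly relative to the law of the Phase I observation `X 0` (two-phase design). The one-phase
design is the case of an `H₀` that ignores its first argument. -/
def nullMeasures {Ω 𝕏 : Type*} [MeasurableSpace Ω] [MeasurableSpace 𝕏]
    (X : ℕ → Ω → 𝕏) (H₀ : Measure 𝕏 → Measure 𝕏 → Prop) (t : ℕ) : Set (Measure Ω) :=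
  {μ | IsProbabilityMeasure μ ∧ ∀ s, 1 ≤ s → s ≤ t → H₀ (μ.map (X 0)) (μ.map (X s))}

/-- The sequence `(Y t)_{t ≥ 1}` is super-uniform with respect to the classes `M t`:
for each `t ≥ 1`, `μ (Y t ≤ α) ≤ α` for every `α ∈ [0,1]` and every `μ ∈ M t`. -/
def SuperUniform {Ω : Type*} [MeasurableSpace Ω] (M : ℕ → Set (Measure Ω))
    (Y : ℕ → Ω → ℝ) : Prop :=
  ∀ t : ℕ, 1 ≤ t → ∀ α ∈ Set.Icc (0 : ℝ) 1, ∀ μ ∈ M t,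
    μ {ω | Y t ω ≤ α} ≤ ENNReal.ofReal α

/-- The EWMA weights `w_{t,1} = (1-λ)^{t-1}` and `w_{t,s} = λ (1-λ)^{t-s}` for `2 ≤ s ≤ t`. -/
def weight (lam : ℝ) (t s : ℕ) : ℝ :=
  if s = 1 then (1 - lam) ^ (t - 1) else lam * (1 - lam) ^ (t - s)

/-- `w_{t,max} = max_{1 ≤ s ≤ t} w_{t,s}` (the supremum of a finite set, nonempty for `t ≥ 1`). -/
def weightMax (lam : ℝ) (t : ℕ) : ℝ :=
  sSup (weight lam t '' Set.Icc 1 t)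

/-- `S_{λ,t}^{(r)} = ∑_{s=1}^t w_{t,s} P_s ^ r`, with values in `[0,∞]`, so that
`0 ^ r = ∞` for `r < 0`. -/
def S {Ω : Type*} (P : ℕ → Ω → unitInterval) (lam r : ℝ) (t : ℕ) (ω : Ω) : ℝ≥0∞ :=
  ∑ s ∈ Finset.Icc 1 t, ENNReal.ofReal (weight lam t s) * ENNReal.ofReal (P s ω : ℝ) ^ r

/-- The scaling constant `a_{λ,t}^{(r)}`. -/
def scale (lam r : ℝ) (t : ℕ) : ℝ :=
  if 1 ≤ r then min (1 + r) (1 / weightMax lam t) ^ (1 / r) else (1 + r) ^ (1 / r)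

/-- `Q_{λ,t}^{(r)} = a_{λ,t}^{(r)} (S_{λ,t}^{(r)}) ^ (1/r)`. For `r < 0` one has `∞ ^ (1/r) = 0`;
the power is always finite, since `P` has values in `[0,1]`, so `toReal` loses nothing. -/
def Q {Ω : Type*} (P : ℕ → Ω → unitInterval) (lam r : ℝ) (t : ℕ) (ω : Ω) : ℝ :=
  scale lam r t * (S P lam r t ω ^ (1 / r)).toReal

end

end EWMAChart

/-!
The argument is Markov's inequality for a function that is calibrated to a uniform variable. For
`0 < α ≤ 1` put `h(x) = ((1 + r) / r) * (1 - (x / α) ^ r)`; both for `r > 0` and for `-1 < r < 0`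
this is decreasing on `(0, ∞)`, vanishes at `α`, and its positive part has integral exactly `α`.
A super-uniform `P` satisfies `E g(P) ≤ ∫₀^∞ g` for every decreasing `g ≥ 0`
(`lintegral_le_of_antitoneOn`, by comparing superlevel sets), hence `E h⁺(P s) ≤ α` for each `s`
(`lintegral_calibrator_le`), whatever the dependence.

If `(1 + r) ^ (1 / r) * (∑ w s * P s ^ r) ^ (1 / r) ≤ α`, then `∑ w s * h⁺(P s) ≥ 1`
(`one_le_sum_calibrator`); as the weights sum to one, Markov's inequality bounds the probability of
this event by `∑ w s * α = α` (`measure_powerMean_le`). When the scaling constant is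
`(1 / w_max) ^ (1 / r)`, the event `Q ≤ α` is contained in `{P s ≤ α}` for an index `s` of maximal
weight, because `w_max * P s ^ r ≤ ∑ w s * P s ^ r`. All of this takes place on the almost sure
event that every `P s` is positive, where the `[0, ∞]`-valued sum `S` is a sum of reals. The level
`α = 0` follows by letting `α` decrease to `0`.
-/

namespace EWMAChart

/-! ### Decreasing functions of super-uniform variables -/

/-- A decreasing nonnegative function of a super-uniform random variable has expectation at most its
Lebesgue integral over `(0, ∞)`. Only the values on `(0, ∞)` matter, as a super-uniform variable is
almost surely positive. -/
lemma lintegral_le_of_antitoneOn {Ω : Type*} [MeasurableSpace Ω] (μ : Measure Ω)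
    {Y : Ω → ℝ} (hY : Measurable Y) (hpos : ∀ᵐ ω ∂μ, 0 < Y ω)
    (hsup : ∀ c, 0 ≤ c → μ {ω | Y ω ≤ c} ≤ ENNReal.ofReal c)
    {g : ℝ → ℝ} (hg : Measurable g) (hg0 : ∀ x, 0 ≤ g x) (hanti : AntitoneOn g (Set.Ioi 0)) :
    ∫⁻ ω, ENNReal.ofReal (g (Y ω)) ∂μ ≤ ∫⁻ x in Set.Ioi (0 : ℝ), ENNReal.ofReal (g x) := by
  rw [lintegral_eq_lintegral_meas_lt μ (Filter.Eventually.of_forall fun ω => hg0 _)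
      (hg.comp hY).aemeasurable,
    lintegral_eq_lintegral_meas_lt _ (Filter.Eventually.of_forall fun x => hg0 _)
      hg.aemeasurable]
  refine lintegral_mono fun t => ?_
  rw [Measure.restrict_apply (measurableSet_lt measurable_const hg)]
  set A : Set ℝ := {x | t < g x} ∩ Set.Ioi 0 with hA
  by_cases htop : volume A = ∞
  · rw [htop]; exact le_top
  -- `A` is an interval with left end point `0`, so its points are bounded by its length.
  have hbd : ∀ x ∈ A, x ≤ (volume A).toReal := fun x hx => by
    have hsub : Set.Ioc 0 x ⊆ A := fun y hy =>
      ⟨lt_of_lt_of_le hx.1 (hanti hy.1 hx.2 hy.2), hy.1⟩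
    have := measure_mono (μ := volume) hsub
    rw [Real.volume_Ioc, sub_zero] at this
    exact (ENNReal.ofReal_le_iff_le_toReal htop).1 this
  calc μ {ω | t < g (Y ω)} ≤ μ {ω | Y ω ≤ (volume A).toReal} := by
        refine measure_mono_ae ?_
        filter_upwards [hpos] with ω hω h
        exact hbd _ ⟨h, hω⟩
    _ ≤ ENNReal.ofReal (volume A).toReal := hsup _ ENNReal.toReal_nonneg
    _ = volume A := ENNReal.ofReal_toReal htop

/-! ### The calibrator -/

/-- The positive part of `((1 + r) / r) * (1 - (x / α) ^ r)`. For `r < 0` its value at `x = 0` is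
junk (the mathematical value is `∞`); it is only used at positive `x`. -/
noncomputable def calibrator (r α x : ℝ) : ℝ :=
  max ((1 + r) / r * (1 - (x / α) ^ r)) 0

lemma measurable_calibrator (r α : ℝ) : Measurable (calibrator r α) := by
  unfold calibrator; fun_prop

lemma calibrator_nonneg (r α x : ℝ) : 0 ≤ calibrator r α x := le_max_right _ _

variable {r α : ℝ}

lemma antitoneOn_calibrator (hr : -1 < r) (hr0 : r ≠ 0) (hα : 0 < α) :
    AntitoneOn (calibrator r α) (Set.Ioi 0) := by
  intro x hx y hy hxy
  have hx' : 0 < x / α := div_pos hx hα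
  have hxy' : x / α ≤ y / α := by gcongr
  refine max_le_max ?_ le_rfl
  rcases lt_or_gt_of_ne hr0 with h | h
  · have := Real.rpow_le_rpow_of_nonpos hx' hxy' h.le
    have hc : (1 + r) / r ≤ 0 := div_nonpos_of_nonneg_of_nonpos (by linarith) h.le
    exact mul_le_mul_of_nonpos_left (by linarith) hc
  · have := Real.rpow_le_rpow hx'.le hxy' h.le
    have hc : 0 ≤ (1 + r) / r := div_nonneg (by linarith) h.le
    exact mul_le_mul_of_nonneg_left (by linarith) hc

lemma calibrator_of_le (hr : -1 < r) (hr0 : r ≠ 0) (hα : 0 < α) {x : ℝ} (hx : 0 < x)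
    (hxα : x ≤ α) : calibrator r α x = (1 + r) / r * (1 - (x / α) ^ r) := by
  have hx' : 0 < x / α := div_pos hx hα
  have hx1 : x / α ≤ 1 := (div_le_one hα).2 hxα
  refine max_eq_left ?_
  rcases lt_or_gt_of_ne hr0 with h | h
  · have := Real.one_le_rpow_of_pos_of_le_one_of_nonpos hx' hx1 h.le
    exact mul_nonneg_of_nonpos_of_nonpos
      (div_nonpos_of_nonneg_of_nonpos (by linarith) h.le) (by linarith)
  · have := Real.rpow_le_one hx'.le hx1 h.le
    exact mul_nonneg (div_nonneg (by linarith) h.le) (by linarith)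

lemma calibrator_of_ge (hr : -1 < r) (hr0 : r ≠ 0) (hα : 0 < α) {x : ℝ} (hxα : α ≤ x) :
    calibrator r α x = 0 := by
  have h1 : calibrator r α α = 0 := by simp [calibrator, div_self hα.ne']
  exact le_antisymm
    (h1 ▸ antitoneOn_calibrator hr hr0 hα hα (hα.trans_le hxα) hxα) (calibrator_nonneg _ _ _)

lemma lintegral_calibrator (hr : -1 < r) (hr0 : r ≠ 0) (hα : 0 < α) :
    ∫⁻ x in Set.Ioi (0 : ℝ), ENNReal.ofReal (calibrator r α x) = ENNReal.ofReal α := by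
  have hint : IntervalIntegrable (fun x : ℝ => (1 + r) / r * (1 - (x / α) ^ r)) volume 0 α := by
    have h0 : IntervalIntegrable (fun x : ℝ => x ^ r / α ^ r) volume 0 α :=
      (intervalIntegral.intervalIntegrable_rpow' hr).div_const _
    have h1 : IntervalIntegrable (fun x : ℝ => (x / α) ^ r) volume 0 α := by
      refine h0.congr fun x hx => ?_
      rw [Set.uIoc_of_le hα.le] at hx
      exact (Real.div_rpow hx.1.le hα.le r).symm
    exact (intervalIntegrable_const.sub h1).const_mul _
  have hval : ∫ x in (0 : ℝ)..α, (1 + r) / r * (1 - (x / α) ^ r) = α := by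
    have h1r : (r + 1) ≠ 0 := by linarith
    rw [intervalIntegral.integral_comp_div (fun x : ℝ => (1 + r) / r * (1 - x ^ r)) hα.ne',
      intervalIntegral.integral_const_mul, intervalIntegral.integral_sub intervalIntegrable_const
        (intervalIntegral.intervalIntegrable_rpow' hr),
      integral_rpow (Or.inl hr), zero_div, div_self hα.ne', Real.zero_rpow h1r]
    simp only [intervalIntegral.integral_const, smul_eq_mul, Real.one_rpow]
    field_simp
    ring
  have hsplit : Set.Ioi (0 : ℝ) = Set.Ioc 0 α ∪ Set.Ioi α :=
    (Set.Ioc_union_Ioi_eq_Ioi hα.le).symm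
  rw [hsplit, lintegral_union measurableSet_Ioi
    (Set.disjoint_left.2 fun x h1 h2 => not_lt.2 h1.2 h2)]
  have hzero : ∫⁻ x in Set.Ioi α, ENNReal.ofReal (calibrator r α x) = 0 := by
    rw [setLIntegral_congr_fun (g := fun _ => 0) measurableSet_Ioi
      (fun x hx => by simp [calibrator_of_ge hr hr0 hα (le_of_lt hx)])]
    simp
  have hcongr : Set.EqOn (calibrator r α) (fun x => (1 + r) / r * (1 - (x / α) ^ r))
      (Set.Ioc 0 α) := fun x hx => calibrator_of_le hr hr0 hα hx.1 hx.2
  have hon : IntegrableOn (calibrator r α) (Set.Ioc 0 α) :=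
    ((intervalIntegrable_iff_integrableOn_Ioc_of_le hα.le).1 hint).congr_fun hcongr.symm
      measurableSet_Ioc
  rw [hzero, add_zero, ← ofReal_integral_eq_lintegral_ofReal hon
    (Filter.Eventually.of_forall fun x => calibrator_nonneg _ _ _),
    setIntegral_congr_fun measurableSet_Ioc hcongr, ← intervalIntegral.integral_of_le hα.le, hval]

lemma lintegral_calibrator_le {Ω : Type*} [MeasurableSpace Ω] (μ : Measure Ω)
    {Y : Ω → ℝ} (hY : Measurable Y) (hpos : ∀ᵐ ω ∂μ, 0 < Y ω)
    (hsup : ∀ c, 0 ≤ c → μ {ω | Y ω ≤ c} ≤ ENNReal.ofReal c)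
    (hr : -1 < r) (hr0 : r ≠ 0) (hα : 0 < α) :
    ∫⁻ ω, ENNReal.ofReal (calibrator r α (Y ω)) ∂μ ≤ ENNReal.ofReal α :=
  (lintegral_le_of_antitoneOn μ hY hpos hsup (measurable_calibrator r α)
    (calibrator_nonneg r α) (antitoneOn_calibrator hr hr0 hα)).trans_eq
    (lintegral_calibrator hr hr0 hα)

/-! ### Weighted power means of dependent super-uniform variables -/

lemma one_le_sum_calibrator {ι : Type*} (s : Finset ι) {w p : ι → ℝ} (hw : ∀ i ∈ s, 0 ≤ w i)
    (hw1 : ∑ i ∈ s, w i = 1) (hp : ∀ i ∈ s, 0 < p i) (hr : -1 < r) (hr0 : r ≠ 0) (hα : 0 < α)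
    (hT : 0 < ∑ i ∈ s, w i * p i ^ r)
    (h : (1 + r) ^ (1 / r) * (∑ i ∈ s, w i * p i ^ r) ^ (1 / r) ≤ α) :
    1 ≤ ∑ i ∈ s, w i * calibrator r α (p i) := by
  set T := ∑ i ∈ s, w i * p i ^ r with hTdef
  have h1r : 0 < 1 + r := by linarith
  have hle : ∑ i ∈ s, w i * ((1 + r) / r * (1 - (p i / α) ^ r))
      ≤ ∑ i ∈ s, w i * calibrator r α (p i) :=
    Finset.sum_le_sum fun i hi => mul_le_mul_of_nonneg_left (le_max_left _ _) (hw i hi)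
  have hsum : ∑ i ∈ s, w i * ((1 + r) / r * (1 - (p i / α) ^ r))
      = (1 + r) / r * (1 - T / α ^ r) := by
    calc _ = ∑ i ∈ s, ((1 + r) / r * w i - (1 + r) / r * (w i * p i ^ r / α ^ r)) := by
          refine Finset.sum_congr rfl fun i hi => ?_
          rw [Real.div_rpow (hp i hi).le hα.le]; ring
      _ = _ := by
          rw [Finset.sum_sub_distrib, ← Finset.mul_sum, ← Finset.mul_sum, ← Finset.sum_div, hw1]
          ring
  refine le_trans ?_ (hsum ▸ hle)
  rw [← Real.mul_rpow h1r.le hT.le] at h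
  have hαr : 0 < α ^ r := Real.rpow_pos_of_pos hα r
  have hprod : 0 < (1 + r) * T := mul_pos h1r hT
  have hroot : (((1 + r) * T) ^ (1 / r)) ^ r = (1 + r) * T := by
    rw [← Real.rpow_mul hprod.le, one_div_mul_cancel hr0, Real.rpow_one]
  have hroot_pos : 0 < ((1 + r) * T) ^ (1 / r) := Real.rpow_pos_of_pos hprod _
  have hform : (1 + r) / r * (1 - T / α ^ r) = 1 + (1 - (1 + r) * T / α ^ r) / r := by
    field_simp; ring
  rw [hform, le_add_iff_nonneg_right]
  rcases lt_or_gt_of_ne hr0 with hneg | hposr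
  · have := Real.rpow_le_rpow_of_nonpos hroot_pos h hneg.le
    rw [hroot] at this
    refine div_nonneg_of_nonpos ?_ hneg.le
    have := (one_le_div hαr).2 this
    linarith
  · have := Real.rpow_le_rpow hroot_pos.le h hposr.le
    rw [hroot] at this
    refine div_nonneg ?_ hposr.le
    have := (div_le_one hαr).2 this
    linarith

/-- The `r`-power mean of super-uniform variables, multiplied by `(1 + r) ^ (1 / r)`, is
super-uniform under arbitrary dependence. -/
lemma measure_powerMean_le {Ω ι : Type*} [MeasurableSpace Ω] (μ : Measure Ω) (s : Finset ι)
    {w : ι → ℝ} (hw : ∀ i ∈ s, 0 < w i) (hw1 : ∑ i ∈ s, w i = 1) {Y : ι → Ω → ℝ}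
    (hY : ∀ i ∈ s, Measurable (Y i)) (hpos : ∀ i ∈ s, ∀ᵐ ω ∂μ, 0 < Y i ω)
    (hsup : ∀ i ∈ s, ∀ c, 0 ≤ c → μ {ω | Y i ω ≤ c} ≤ ENNReal.ofReal c)
    (hr : -1 < r) (hr0 : r ≠ 0) (hα : 0 < α) :
    μ {ω | (1 + r) ^ (1 / r) * (∑ i ∈ s, w i * Y i ω ^ r) ^ (1 / r) ≤ α} ≤ ENNReal.ofReal α := by
  have hne : s.Nonempty := Finset.nonempty_of_sum_ne_zero (hw1 ▸ one_ne_zero)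
  let F : Ω → ℝ≥0∞ := fun ω =>
    ∑ i ∈ s, ENNReal.ofReal (w i) * ENNReal.ofReal (calibrator r α (Y i ω))
  have hmeas : ∀ i ∈ s, Measurable fun ω => ENNReal.ofReal (calibrator r α (Y i ω)) :=
    fun i hi => ((measurable_calibrator r α).comp (hY i hi)).ennreal_ofReal
  have hFm : AEMeasurable F μ :=
    (Finset.measurable_fun_sum s fun i hi => (hmeas i hi).const_mul _).aemeasurable
  have hall : ∀ᵐ ω ∂μ, ∀ i ∈ s, 0 < Y i ω := (Finset.eventually_all s).2 hpos
  calc _ ≤ μ {ω | 1 ≤ F ω} := by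
        refine measure_mono_ae ?_
        filter_upwards [hall] with ω hω h
        have hT : 0 < ∑ i ∈ s, w i * Y i ω ^ r :=
          Finset.sum_pos (fun i hi => mul_pos (hw i hi) (Real.rpow_pos_of_pos (hω i hi) r)) hne
        have h1 := one_le_sum_calibrator s (fun i hi => (hw i hi).le) hw1 hω hr hr0 hα hT h
        have hF : F ω = ENNReal.ofReal (∑ i ∈ s, w i * calibrator r α (Y i ω)) := by
          rw [ENNReal.ofReal_sum_of_nonneg fun i hi =>
            mul_nonneg (hw i hi).le (calibrator_nonneg _ _ _)]
          exact Finset.sum_congr rfl fun i hi => (ENNReal.ofReal_mul (hw i hi).le).symm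
        change 1 ≤ F ω
        rw [hF]
        exact ENNReal.one_le_ofReal.2 h1
    _ ≤ ∫⁻ ω, F ω ∂μ := by simpa using mul_meas_ge_le_lintegral₀ hFm 1
    _ = ∑ i ∈ s, ENNReal.ofReal (w i) * ∫⁻ ω, ENNReal.ofReal (calibrator r α (Y i ω)) ∂μ := by
        rw [lintegral_finsetSum' _ fun i hi => ((hmeas i hi).const_mul _).aemeasurable]
        exact Finset.sum_congr rfl fun i hi => lintegral_const_mul _ (hmeas i hi)
    _ ≤ ∑ i ∈ s, ENNReal.ofReal (w i) * ENNReal.ofReal α :=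
        Finset.sum_le_sum fun i hi => by
          gcongr
          exact lintegral_calibrator_le μ (hY i hi) (hpos i hi) (hsup i hi) hr hr0 hα
    _ = ENNReal.ofReal α := by
        rw [← Finset.sum_mul, ← ENNReal.ofReal_sum_of_nonneg fun i hi => (hw i hi).le, hw1,
          ENNReal.ofReal_one, one_mul]

/-! ### The EWMA weights and the combined statistic -/

variable {lam : ℝ} {t : ℕ}

lemma weight_pos (hlam : lam ∈ Set.Ioo (0 : ℝ) 1) (t s : ℕ) : 0 < weight lam t s := by
  have h1 : 0 < 1 - lam := by linarith [hlam.2]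
  unfold weight
  split_ifs
  · exact pow_pos h1 _
  · exact mul_pos hlam.1 (pow_pos h1 _)

/-- Passing from `t` to `t + 1` multiplies the weights of the past by `1 - λ` and gives the new
observation the weight `λ`. -/
lemma sum_weight (lam : ℝ) (ht : 1 ≤ t) : ∑ s ∈ Finset.Icc 1 t, weight lam t s = 1 := by
  induction t, ht using Nat.le_induction with
  | base => simp [weight]
  | succ t ht ih =>
    rw [Finset.sum_Icc_succ_top (by omega)]
    have hlast : weight lam (t + 1) (t + 1) = lam := by
      simp [weight, show t ≠ 0 by omega]
    have hstep : ∀ s ∈ Finset.Icc 1 t, weight lam (t + 1) s = (1 - lam) * weight lam t s := by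
      intro s hs
      have hst := (Finset.mem_Icc.1 hs).2
      unfold weight
      split_ifs
      · rw [← pow_succ']; congr 1; omega
      · rw [show t + 1 - s = (t - s) + 1 by omega, pow_succ]; ring
    rw [Finset.sum_congr rfl hstep, ← Finset.mul_sum, ih, hlast]
    ring

lemma exists_weight_eq_weightMax (lam : ℝ) (ht : 1 ≤ t) :
    ∃ s ∈ Finset.Icc 1 t, weight lam t s = weightMax lam t := by
  have hmem : weightMax lam t ∈ weight lam t '' Set.Icc 1 t :=
    Set.Nonempty.csSup_mem ((Set.nonempty_Icc.2 ht).image _) ((Set.finite_Icc 1 t).image _)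
  obtain ⟨s, hs, h⟩ := hmem
  exact ⟨s, Finset.mem_Icc.2 hs, h⟩

lemma measurable_Q {Ω : Type*} [MeasurableSpace Ω] {P : ℕ → Ω → unitInterval}
    (hPm : ∀ t, 1 ≤ t → Measurable (P t)) (lam r : ℝ) (t : ℕ) : Measurable (Q P lam r t) := by
  have hS : Measurable (S P lam r t) :=
    Finset.measurable_fun_sum _ fun s hs =>
      (((hPm s (Finset.mem_Icc.1 hs).1).subtype_val.ennreal_ofReal).pow_const r).const_mul _
  exact ((hS.pow_const (1 / r)).ennreal_toReal).const_mul _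

/-- On the event that all `P s` are positive, the `[0, ∞]`-valued power sum is a sum of reals. -/
lemma Q_eq_of_pos {Ω : Type*} {P : ℕ → Ω → unitInterval} (hlam : lam ∈ Set.Ioo (0 : ℝ) 1)
    {ω : Ω} (hω : ∀ s ∈ Finset.Icc 1 t, 0 < (P s ω : ℝ)) :
    Q P lam r t ω
      = scale lam r t * (∑ s ∈ Finset.Icc 1 t, weight lam t s * (P s ω : ℝ) ^ r) ^ (1 / r) := by
  have hterm : ∀ s ∈ Finset.Icc 1 t, 0 ≤ weight lam t s * (P s ω : ℝ) ^ r := fun s hs =>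
    mul_nonneg (weight_pos hlam t s).le (Real.rpow_nonneg (hω s hs).le r)
  have hS : S P lam r t ω
      = ENNReal.ofReal (∑ s ∈ Finset.Icc 1 t, weight lam t s * (P s ω : ℝ) ^ r) := by
    rw [ENNReal.ofReal_sum_of_nonneg hterm]
    refine Finset.sum_congr rfl fun s hs => ?_
    rw [ENNReal.ofReal_mul (weight_pos hlam t s).le, ENNReal.ofReal_rpow_of_pos (hω s hs)]
  rw [Q, hS, ← ENNReal.toReal_rpow, ENNReal.toReal_ofReal (Finset.sum_nonneg hterm)]

/-- Each summand is at most the whole sum, so `(1 / w i) ^ (1 / r)` times the weighted power mean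
dominates `p i`. -/
lemma le_of_inv_weight_mul_powerSum_le {ι : Type*} (s : Finset ι) {w p : ι → ℝ}
    (hw : ∀ i ∈ s, 0 < w i) (hp : ∀ i ∈ s, 0 ≤ p i) (hr : 0 < r) {i : ι} (hi : i ∈ s)
    (h : (1 / w i) ^ (1 / r) * (∑ j ∈ s, w j * p j ^ r) ^ (1 / r) ≤ α) : p i ≤ α := by
  have hterm : ∀ j ∈ s, 0 ≤ w j * p j ^ r := fun j hj =>
    mul_nonneg (hw j hj).le (Real.rpow_nonneg (hp j hj) r)
  have hle := Finset.single_le_sum hterm hi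
  rw [← Real.mul_rpow (one_div_nonneg.2 (hw i hi).le) (Finset.sum_nonneg hterm)] at h
  refine le_trans ?_ h
  rw [one_div r]
  rw [Real.le_rpow_inv_iff_of_pos (hp i hi)
    (mul_nonneg (one_div_nonneg.2 (hw i hi).le) (Finset.sum_nonneg hterm)) hr]
  rw [one_div, ← div_eq_inv_mul, le_div_iff₀ (hw i hi), mul_comm]
  exact hle

lemma measure_Q_le_of_pos {Ω : Type*} [MeasurableSpace Ω] (μ : Measure Ω) [IsProbabilityMeasure μ]
    {P : ℕ → Ω → unitInterval} (hPm : ∀ t, 1 ≤ t → Measurable (P t)) (ht : 1 ≤ t)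
    (hP : ∀ s ∈ Finset.Icc 1 t, ∀ c ∈ Set.Icc (0 : ℝ) 1,
      μ {ω | (P s ω : ℝ) ≤ c} ≤ ENNReal.ofReal c)
    (hlam : lam ∈ Set.Ioo (0 : ℝ) 1) (hr : -1 < r) (hr0 : r ≠ 0) (hα : 0 < α) :
    μ {ω | Q P lam r t ω ≤ α} ≤ ENNReal.ofReal α := by
  have hsup : ∀ s ∈ Finset.Icc 1 t, ∀ c, 0 ≤ c → μ {ω | (P s ω : ℝ) ≤ c} ≤ ENNReal.ofReal c := by
    intro s hs c hc
    rcases le_total c 1 with h | h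
    · exact hP s hs c ⟨hc, h⟩
    · exact prob_le_one.trans (ENNReal.one_le_ofReal.2 h)
  have hpos : ∀ s ∈ Finset.Icc 1 t, ∀ᵐ ω ∂μ, 0 < (P s ω : ℝ) := fun s hs => by
    rw [ae_iff]
    simpa only [not_lt, ENNReal.ofReal_zero, nonpos_iff_eq_zero] using hsup s hs 0 le_rfl
  have hall := (Finset.eventually_all (Finset.Icc 1 t)).2 hpos
  have hw : ∀ s ∈ Finset.Icc 1 t, 0 < weight lam t s := fun s _ => weight_pos hlam t s
  have hmean := measure_powerMean_le μ (Finset.Icc 1 t) hw (sum_weight lam ht)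
    (Y := fun s ω => (P s ω : ℝ)) (fun s hs => (hPm s (Finset.mem_Icc.1 hs).1).subtype_val)
    hpos hsup hr hr0 hα
  have hcase : scale lam r t = (1 + r) ^ (1 / r) ∨
      1 ≤ r ∧ scale lam r t = (1 / weightMax lam t) ^ (1 / r) := by
    unfold scale
    split_ifs with h
    · rcases min_choice (1 + r) (1 / weightMax lam t) with h' | h'
      · exact Or.inl (by rw [h'])
      · exact Or.inr ⟨h, by rw [h']⟩
    · exact Or.inl rfl
  rcases hcase with h | ⟨hr1, h⟩
  · refine le_trans (measure_mono_ae ?_) hmean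
    filter_upwards [hall] with ω hω hQ
    have hQ' : Q P lam r t ω ≤ α := hQ
    rwa [Q_eq_of_pos hlam hω, h] at hQ'
  · obtain ⟨s, hs, hmax⟩ := exists_weight_eq_weightMax lam ht
    refine le_trans (measure_mono_ae ?_) (hsup s hs α hα.le)
    filter_upwards [hall] with ω hω hQ
    have hQ' : Q P lam r t ω ≤ α := hQ
    rw [Q_eq_of_pos hlam hω, h, ← hmax] at hQ'
    exact le_of_inv_weight_mul_powerSum_le (Finset.Icc 1 t) (p := fun s => (P s ω : ℝ)) hw
      (fun j hj => (hω j hj).le) (by linarith) hs hQ'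

lemma superUniform_Q {Ω 𝕏 : Type*} [MeasurableSpace Ω] [MeasurableSpace 𝕏] {X : ℕ → Ω → 𝕏}
    {H₀ : Measure 𝕏 → Measure 𝕏 → Prop} {P : ℕ → Ω → unitInterval}
    (hPm : ∀ t, 1 ≤ t → Measurable (P t))
    (hP : SuperUniform (nullMeasures X H₀) (fun t ω => (P t ω : ℝ)))
    (hlam : lam ∈ Set.Ioo (0 : ℝ) 1) (hr : -1 < r) (hr0 : r ≠ 0) :
    SuperUniform (nullMeasures X H₀) (Q P lam r) := by
  intro t ht α hα μ hμ
  have := hμ.1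
  have key : ∀ β : ℝ, 0 < β → μ {ω | Q P lam r t ω ≤ β} ≤ ENNReal.ofReal β := fun β hβ =>
    measure_Q_le_of_pos μ hPm ht
      -- The classes `nullMeasures X H₀ s` decrease in `s`, so `μ` belongs to those with `s ≤ t`.
      (fun s hs c hc => hP s (Finset.mem_Icc.1 hs).1 c hc μ
        ⟨hμ.1, fun u hu hus => hμ.2 u hu (hus.trans (Finset.mem_Icc.1 hs).2)⟩)
      hlam hr hr0 hβ
  have hlim : Filter.Tendsto ENNReal.ofReal (nhdsWithin α (Set.Ioi α))
      (nhds (ENNReal.ofReal α)) :=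
    (ENNReal.continuous_ofReal.tendsto α).mono_left nhdsWithin_le_nhds
  refine ge_of_tendsto hlim ?_
  filter_upwards [self_mem_nhdsWithin] with β hβ
  exact (measure_mono fun ω (hω : Q P lam r t ω ≤ α) => hω.trans (le_of_lt hβ)).trans
    (key β (lt_of_le_of_lt hα.1 hβ))

end EWMAChart

theorem proposition5 {Ω 𝕏 : Type*} [MeasurableSpace Ω]
    [MetricSpace 𝕏] [MeasurableSpace 𝕏] [BorelSpace 𝕏]
    (X : ℕ → Ω → 𝕏) (hX : ∀ t, Measurable (X t))
    (H₀ : Measure 𝕏 → Measure 𝕏 → Prop)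
    (P : ℕ → Ω → unitInterval) (hPm : ∀ t, 1 ≤ t → Measurable (P t))
    (hP : EWMAChart.SuperUniform (EWMAChart.nullMeasures X H₀) (fun t ω => (P t ω : ℝ)))
    (lam : ℝ) (hlam : lam ∈ Set.Ioo (0 : ℝ) 1) (r : ℝ) (hr : -1 < r) (hr0 : r ≠ 0) :
    (∀ t, 1 ≤ t → Measurable (EWMAChart.Q P lam r t)) ∧
    EWMAChart.SuperUniform (EWMAChart.nullMeasures X H₀) (EWMAChart.Q P lam r) ∧
    ∀ P₀ : Measure Ω, (∀ t, 1 ≤ t → P₀ ∈ EWMAChart.nullMeasures X H₀ t) →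
      ∀ α ∈ Set.Icc (0 : ℝ) 1, ∀ t, 1 ≤ t →
        P₀ {ω | EWMAChart.Q P lam r t ω ≤ α} ≤ ENNReal.ofReal α := by
  have h := EWMAChart.superUniform_Q hPm hP hlam hr hr0
  exact ⟨fun t _ => EWMAChart.measurable_Q hPm lam r t, h,
    fun P₀ hP₀ α hα t ht => h t ht α hα P₀ (hP₀ t ht)⟩
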